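/- Fix a function-free first-order language with finitely many predicate symbols and finitely many (and at least one) constants. A confidence level is a tuple $c=\langle[\alpha,\beta],[\gamma,\delta]\rangle$ with entries in $[0,1]$; the truth order is $c_1\le_t c_2$ iff $\alpha_1\le\alpha_2$, $\beta_1\le\beta_2$, $\gamma_2\le\gamma_1$, $\delta_2\le\delta_1$, with least element $\bot_t=\langle[0,0],[1,1]\rangle$. It is consistent if there are $w_1,w_0,w\ge 0$ with $w_1+w_0+w=1$, $\alpha\le w_1\le\beta$ and $\gamma\le w_0\le\delta$. Write $a\oplus b=\min\{1,a+b\}$, $a\odot b=\max\{0,a+b-1\}$ and $a\mathbin{\bar\cdot}b=1-(1-a)(1-b)$. There are five modes $\mu$ (ignorance, independence, positive correlation, negative correlation, mutual exclusion), with - $c_1\wedge_{ig}c_2=\langle[\alpha_1\odot\alpha_2,\min\{\beta_1,\beta_2\}],[\max\{\gamma_1,\gamma_2\},\delta_1\oplus\delta_2]\rangle$, - $c_1\wedge_{ind}c_2=\langle[\alpha_1\alpha_2,\beta_1\beta_2],[\gamma_1\mathbin{\bar\cdot}\gamma_2,\delta_1\mathbin{\bar\cdot}\delta_2]\rangle$,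 - $c_1\wedge_{pc}c_2=\langle[\min\{\alpha_1,\alpha_2\},\min\{\beta_1,\beta_2\}],[\max\{\gamma_1,\gamma_2\},\max\{\delta_1,\delta_2\}]\rangle$, - $c_1\wedge_{nc}c_2=\langle[\alpha_1\odot\alpha_2,\beta_1\odot\beta_2],[\gamma_1\oplus\gamma_2,\delta_1\oplus\delta_2]\rangle$, - $c_1\wedge_{me}c_2=\langle[0,0],[\gamma_1\oplus\gamma_2,\delta_1\oplus\delta_2]\rangle$; for $\mu\in\{ig,ind,pc,nc\}$ the disjunction $c_1\vee_\mu c_2$ is obtained from the formula for $\wedge_\mu$ by exchanging the roles of belief and doubt, that is, of $(\alpha_i,\beta_i)$ and $(\gamma_i,\delta_i)$, in the arguments and in the result; in particular $c_1\vee_{pc}c_2=\langle[\max\{\alpha_1,\alpha_2\},\max\{\beta_1,\beta_2\}],[\min\{\gamma_1,\gamma_2\},\min\{\delta_1,\delta_2\}]\rangle$. Finally $c_1\vee_{me}c_2=\langle[\alpha_1\oplus\alpha_2,\beta_1\oplus\beta_2],[\gamma_1\odot\gamma_2,\delta_1\odot\delta_2]\rangle$. A p-rule is a rule $A\xleftarrow{c}B_1,\dots,B_m$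 ($m\ge0$) between atoms, with a consistent confidence level $c$, a conjunctive mode $\mu_r$ (absent if $m=0$) and a disjunctive mode $\mu_p$, in which every variable of $A$ occurs in some $B_j$. A p-program $P$ is a finite set of p-rules in which rules with the same head predicate have the same disjunctive mode. Its Herbrand universe consists of the constants occurring in $P$ (one arbitrary constant if there are none), its Herbrand base $B_P$ of the ground atoms over them with predicates occurring in $P$, and its Herbrand instantiation $P^*$ is the set of all ground instances of its p-rules over the Herbrand universe. A valuation is a map $v$ from $B_P$ to confidence levels; valuations are ordered pointwise by $\le_t$. Put $$T_P(v)(A)=\bigvee\nolimits_{\mu_p}\{\,c\wedge_{\mu_r}v(B_1)\wedge_{\mu_r}\cdots\wedge_{\mu_r}v(B_m)\,\},$$ where the disjunction has one term for each p-rule $(A\xleftarrow{c}B_1,\dots,B_m;\mu_r,\mu_p)$ in $P^*$ with head $A$, and the empty disjunction is $\bot_t$. Let $T_P\uparrow0$ be constantly $\bot_t$ and $T_P\uparrow(n+1)=T_P(T_P\uparrow n)$. Naive bottom-up evaluation computes $T_P\uparrow1,T_P\uparrow2,\dots$ and stops after the first iteration $n\ge1$ with $T_P\uparrow n=T_P\uparrow(n-1)$.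 A predicate is recursive if it depends on itself in the transitive closure of the relation "$p$ is the head predicate of a rule of $P$ whose body contains the predicate $q$". A disjunctive derivation tree (DDT) for $A\in B_P$ is a finite tree with goal nodes labelled by elements of $B_P$ and rule nodes labelled by elements of $P^*$. Its root is a goal node labelled $A$. The children of a goal node labelled $B$ are rule nodes, at least one, labelled by pairwise distinct rules of $P^*$ with head $B$. A rule node has one goal child for each atom of the body of its rule, labelled by that atom (so facts are leaves). The height is the largest number of edges on a path from the root to a leaf. A branch contains the root, exactly one rule child of each of its goal nodes, and all goal children of each of its rule nodes. A DDT is simple if no branch contains two goal nodes with the same label one of which is a proper ancestor of the other. **Theorem.** Let $P$ be a p-program in which every recursive predicate has positive correlation as its disjunctive mode. Let $k\ge1$ be such that $$\max\{\operatorname{height}(T)\mid A\in B_P,\ T\text{ a simple DDT for }A\}=2k-1 .$$ Then naive bottom-up evaluation stops after some number $n\le k+1$ of iterations, and its result $T_P\uparrow n$ is the least fixpoint of $T_P$. -/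

import Mathlib

namespace PDD

/-! ### Confidence levels and the truth order -/

/-- A confidence level `⟨[α, β], [γ, δ]⟩`: a belief interval `[α, β]` and a doubt interval
`[γ, δ]` with endpoints in `[0, 1]`. As in the usual trilattice of confidence levels, formal
intervals such as `[1, 0]` are elements too; see `ConfLevel.Consistent`. -/
@[ext]
structure ConfLevel where
  α : unitInterval
  β : unitInterval
  γ : unitInterval
  δ : unitInterval

namespace ConfLevel

/-- The truth order: belief goes up and doubt comes down. -/
instance : PartialOrder ConfLevel where
  le c d := c.α ≤ d.α ∧ c.β ≤ d.β ∧ d.γ ≤ c.γ ∧ d.δ ≤ c.δ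
  le_refl _ := ⟨le_rfl, le_rfl, le_rfl, le_rfl⟩
  le_trans _ _ _ h h' :=
    ⟨h.1.trans h'.1, h.2.1.trans h'.2.1, h'.2.2.1.trans h.2.2.1, h'.2.2.2.trans h.2.2.2⟩
  le_antisymm _ _ h h' := by
    ext1
    · exact le_antisymm h.1 h'.1
    · exact le_antisymm h.2.1 h'.2.1
    · exact le_antisymm h'.2.2.1 h.2.2.1
    · exact le_antisymm h'.2.2.2 h.2.2.2

/-- The least element `⟨[0, 0], [1, 1]⟩` of the truth order. -/
def botT : ConfLevel := ⟨0, 0, 1, 1⟩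

/-- Some probabilities `w₁` (true), `w₀` (false) and `w` (unknown), which sum up to `1`, satisfy
`α ≤ w₁ ≤ β` and `γ ≤ w₀ ≤ δ`. -/
def Consistent (c : ConfLevel) : Prop :=
  ∃ w₁ w₀ w : ℝ, 0 ≤ w₁ ∧ 0 ≤ w₀ ∧ 0 ≤ w ∧ w₁ + w₀ + w = 1 ∧
    (c.α : ℝ) ≤ w₁ ∧ w₁ ≤ c.β ∧ (c.γ : ℝ) ≤ w₀ ∧ w₀ ≤ c.δ

end ConfLevel

/-! ### Combination modes -/

/-- The modes: ignorance, independence, positive correlation, negative correlation, mutual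
exclusion. -/
inductive Mode
  | ig
  | ind
  | pc
  | nc
  | me

/-- The number `min {1, a + b}`. -/
def addTrunc (a b : unitInterval) : unitInterval :=
  ⟨min 1 ((a : ℝ) + b), le_min zero_le_one (add_nonneg a.2.1 b.2.1), min_le_left _ _⟩

/-- The number `max {0, a + b - 1}`. -/
def subTrunc (a b : unitInterval) : unitInterval :=
  ⟨max 0 ((a : ℝ) + b - 1), le_max_left _ _,
    max_le zero_le_one (by linarith [a.2.2, b.2.2])⟩

/-- The number `1 - (1 - a) * (1 - b)`. -/
def probSum (a b : unitInterval) : unitInterval :=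
  unitInterval.symm (unitInterval.symm a * unitInterval.symm b)

/-- Conjunction of confidence levels under a mode. -/
def ConfLevel.conj : Mode → ConfLevel → ConfLevel → ConfLevel
  | .ig, c, d => ⟨subTrunc c.α d.α, min c.β d.β, max c.γ d.γ, addTrunc c.δ d.δ⟩
  | .ind, c, d => ⟨c.α * d.α, c.β * d.β, probSum c.γ d.γ, probSum c.δ d.δ⟩
  | .pc, c, d => ⟨min c.α d.α, min c.β d.β, max c.γ d.γ, max c.δ d.δ⟩
  | .nc, c, d =>
    ⟨subTrunc c.α d.α, subTrunc c.β d.β, addTrunc c.γ d.γ, addTrunc c.δ d.δ⟩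
  | .me, c, d => ⟨0, 0, addTrunc c.γ d.γ, addTrunc c.δ d.δ⟩

/-- Disjunction of confidence levels under a mode. For mutual exclusion the belief is
`[α₁ + α₂, β₁ + β₂]`, which presupposes `β₁ + β₂ ≤ 1`; in the remaining case the formula for
negative correlation is used, that is, the sums are cut off at `1`. -/
def ConfLevel.disj : Mode → ConfLevel → ConfLevel → ConfLevel
  | .ig, c, d => ⟨max c.α d.α, addTrunc c.β d.β, subTrunc c.γ d.γ, min c.δ d.δ⟩
  | .ind, c, d => ⟨probSum c.α d.α, probSum c.β d.β, c.γ * d.γ, c.δ * d.δ⟩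
  | .pc, c, d => ⟨max c.α d.α, max c.β d.β, min c.γ d.γ, min c.δ d.δ⟩
  | .nc, c, d =>
    ⟨addTrunc c.α d.α, addTrunc c.β d.β, subTrunc c.γ d.γ, subTrunc c.δ d.δ⟩
  | .me, c, d =>
    ⟨addTrunc c.α d.α, addTrunc c.β d.β, subTrunc c.γ d.γ, subTrunc c.δ d.δ⟩

theorem addTrunc_comm (a b : unitInterval) : addTrunc a b = addTrunc b a := by
  simp [addTrunc, add_comm]

theorem subTrunc_comm (a b : unitInterval) : subTrunc a b = subTrunc b a := by
  simp [subTrunc, add_comm]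

theorem probSum_comm (a b : unitInterval) : probSum a b = probSum b a := by
  simp [probSum, mul_comm]

theorem addTrunc_assoc (a b c : unitInterval) :
    addTrunc (addTrunc a b) c = addTrunc a (addTrunc b c) := by
  obtain ⟨a, ha⟩ := a
  obtain ⟨b, hb⟩ := b
  obtain ⟨c, hc⟩ := c
  apply Subtype.ext
  simp only [addTrunc]
  have := ha.1; have := hb.1; have := hc.1
  grind

theorem subTrunc_assoc (a b c : unitInterval) :
    subTrunc (subTrunc a b) c = subTrunc a (subTrunc b c) := by
  obtain ⟨a, ha⟩ := a
  obtain ⟨b, hb⟩ := b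
  obtain ⟨c, hc⟩ := c
  apply Subtype.ext
  simp only [subTrunc]
  have := ha.2; have := hb.2; have := hc.2
  grind

theorem probSum_assoc (a b c : unitInterval) :
    probSum (probSum a b) c = probSum a (probSum b c) := by
  simp [probSum, mul_assoc]

instance (μ : Mode) : Std.Commutative (ConfLevel.disj μ) where
  comm c d := by
    cases μ <;>
      simp [ConfLevel.disj, max_comm, min_comm, addTrunc_comm, subTrunc_comm, probSum_comm,
        mul_comm]

instance (μ : Mode) : Std.Associative (ConfLevel.disj μ) where
  assoc c d e := by
    cases μ <;>
      simp [ConfLevel.disj, max_assoc, min_assoc, addTrunc_assoc, subTrunc_assoc,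
        probSum_assoc, mul_assoc]

/-! ### Syntax of probabilistic programs -/

/-- The vocabulary of a function-free first-order language with finitely many predicate symbols
and finitely many constants (and at least one constant). The variables are the natural numbers. -/
structure Lang where
  Pred : Type
  arity : Pred → ℕ
  Const : Type
  [finPred : Finite Pred]
  [finConst : Finite Const]
  [nonemptyConst : Nonempty Const]

attribute [instance] Lang.finPred Lang.finConst Lang.nonemptyConst

/-- A term: a variable or a constant. -/
inductive Term (L : Lang)
  | var (x : ℕ)
  | const (c : L.Const)

/-- An atom with arguments of type `τ`; `Atom L (Term L)` are the atoms of the language and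
`Atom L L.Const` the ground atoms. -/
@[ext]
structure Atom (L : Lang) (τ : Type) where
  pred : L.Pred
  args : Fin (L.arity pred) → τ

/-- The result of replacing each variable `x` of the term by the constant `θ x`. -/
def Term.subst {L : Lang} (θ : ℕ → L.Const) : Term L → L.Const
  | .var x => θ x
  | .const c => c

/-- The ground atom obtained from an atom by a ground substitution. -/
def Atom.subst {L : Lang} (θ : ℕ → L.Const) (a : Atom L (Term L)) : Atom L L.Const :=
  ⟨a.pred, fun i => (a.args i).subst θ⟩

/-- A p-rule `(head ←conf- body; conjMode, disjMode)` over atoms of type `τ`. -/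
@[ext]
structure PRule (τ : Type) where
  head : τ
  conf : ConfLevel
  body : List τ
  conjMode : Mode
  disjMode : Mode

/-- Apply a function to all atoms of a p-rule. -/
def PRule.map {τ σ : Type} (f : τ → σ) (r : PRule τ) : PRule σ :=
  ⟨f r.head, r.conf, r.body.map f, r.conjMode, r.disjMode⟩

/-- A p-program: a finite set of range restricted p-rules with consistent confidence levels, such
that p-rules which define the same predicate have the same disjunctive mode. -/
structure PProgram (L : Lang) where
  rules : Set (PRule (Atom L (Term L)))
  finite : rules.Finite
  /-- The confidence level of a rule is consistent. -/
  consistent : ∀ r ∈ rules, r.conf.Consistent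
  /-- Each variable of the head occurs in the body. -/
  rangeRestricted : ∀ r ∈ rules, ∀ x i, r.head.args i = .var x →
    ∃ b ∈ r.body, ∃ j, b.args j = .var x
  /-- A fact has no conjunctive mode: its entry has a fixed, meaningless value. -/
  factMode : ∀ r ∈ rules, r.body = [] → r.conjMode = .pc
  /-- The disjunctive mode depends only on the predicate that is defined. -/
  disjMode_eq : ∀ r ∈ rules, ∀ s ∈ rules, r.head.pred = s.head.pred → r.disjMode = s.disjMode

namespace PProgram

variable {L : Lang} (P : PProgram L)

/-- The atom `a` occurs in the program, in the head or in the body of a rule. -/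
def Occurs (a : Atom L (Term L)) : Prop :=
  ∃ r ∈ P.rules, a = r.head ∨ a ∈ r.body

/-- The constant `c` occurs in the program. -/
def OccursConst (c : L.Const) : Prop :=
  ∃ a, P.Occurs a ∧ ∃ i, a.args i = .const c

/-- The Herbrand universe: the constants that occur in the program or, if there are none, one
arbitrary constant. -/
def herbrandUniverse : Set L.Const :=
  {c | P.OccursConst c ∨ ((∀ d, ¬ P.OccursConst d) ∧ c = Classical.arbitrary L.Const)}

/-- The Herbrand base: the ground atoms over the Herbrand universe with a predicate that occurs in
the program. -/
abbrev HerbrandBase : Type :=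
  {A : Atom L L.Const //
    (∃ a, P.Occurs a ∧ a.pred = A.pred) ∧ ∀ i, A.args i ∈ P.herbrandUniverse}

instance finite_atom : Finite (Atom L L.Const) :=
  Finite.of_injective
    (fun A : Atom L L.Const =>
      (⟨A.pred, A.args⟩ : (p : L.Pred) × (Fin (L.arity p) → L.Const)))
    (by
      rintro ⟨p, a⟩ ⟨q, b⟩ h
      simpa using h)

/-- The Herbrand instantiation: the set of the ground p-rules `r θ`, where `r` is a p-rule of the
program and `θ` maps the variables to the Herbrand universe. All atoms of `r θ` belong to the
Herbrand base by `exists_instance`. -/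
def instantiation : Set (PRule P.HerbrandBase) :=
  {ρ | ∃ r ∈ P.rules, ∃ θ : ℕ → L.Const, (∀ x, θ x ∈ P.herbrandUniverse) ∧
    ρ.map Subtype.val = r.map (Atom.subst θ)}

theorem subst_mem {a : Atom L (Term L)} (ha : P.Occurs a) {θ : ℕ → L.Const}
    (hθ : ∀ x, θ x ∈ P.herbrandUniverse) :
    (∃ b, P.Occurs b ∧ b.pred = (a.subst θ).pred) ∧
      ∀ i, (a.subst θ).args i ∈ P.herbrandUniverse := by
  refine ⟨⟨a, ha, rfl⟩, fun i => ?_⟩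
  change (a.args i).subst θ ∈ _
  rcases h : a.args i with x | c
  · exact hθ x
  · exact Or.inl ⟨a, ha, i, h⟩

theorem exists_instance {r : PRule (Atom L (Term L))} (hr : r ∈ P.rules) {θ : ℕ → L.Const}
    (hθ : ∀ x, θ x ∈ P.herbrandUniverse) :
    ∃ ρ ∈ P.instantiation, ρ.map Subtype.val = r.map (Atom.subst θ) := by
  have h : ∀ a ∈ r.body, P.Occurs a := fun a ha => ⟨r, hr, Or.inr ha⟩
  let ρ : PRule P.HerbrandBase :=
    ⟨⟨r.head.subst θ, P.subst_mem ⟨r, hr, Or.inl rfl⟩ hθ⟩, r.conf,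
      r.body.pmap (fun a ha => ⟨a.subst θ, P.subst_mem ha hθ⟩) h, r.conjMode, r.disjMode⟩
  have hρ : ρ.map Subtype.val = r.map (Atom.subst θ) := by
    simp [ρ, PRule.map, List.map_pmap]
  exact ⟨ρ, ⟨r, hr, θ, hθ, hρ⟩, hρ⟩

theorem instantiation_finite : P.instantiation.Finite := by
  refine (P.finite.biUnion (t := fun r => Set.range
    (fun x : P.HerbrandBase × (Fin r.body.length → P.HerbrandBase) =>
      (⟨x.1, r.conf, List.ofFn x.2, r.conjMode, r.disjMode⟩ : PRule P.HerbrandBase)))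
    (fun r _ => Set.finite_range _)).subset ?_
  rintro ⟨A, c, b, m, d⟩ ⟨r, hr, θ, -, h⟩
  simp only [PRule.map, PRule.mk.injEq] at h
  obtain ⟨-, hc, hb, hm, hd⟩ := h
  have hl : b.length = r.body.length := by simpa using congrArg List.length hb
  refine Set.mem_biUnion hr ⟨(A, fun i => b.get (i.cast hl.symm)), ?_⟩
  simp only [PRule.mk.injEq, true_and]
  refine ⟨hc.symm, ?_, hm.symm, hd.symm⟩
  apply List.ext_get (by simp [hl])
  intro n h₁ h₂
  simp

/-- The ground p-rules of the Herbrand instantiation which define the atom `A`. -/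
noncomputable def rulesFor (A : P.HerbrandBase) : Finset (PRule P.HerbrandBase) :=
  (P.instantiation_finite.subset (Set.sep_subset _ (fun ρ => ρ.head = A))).toFinset

theorem mem_rulesFor {A : P.HerbrandBase} {ρ : PRule P.HerbrandBase} :
    ρ ∈ P.rulesFor A ↔ ρ ∈ P.instantiation ∧ ρ.head = A := by
  simp [rulesFor]

/-- The disjunctive mode of the predicate `p`, read off from any p-rule which defines `p` (the
value for a predicate without rules is never used). -/
noncomputable def modeOf (p : L.Pred) : Mode :=
  open Classical in
  if h : ∃ r ∈ P.rules, r.head.pred = p then h.choose.disjMode else .pc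

theorem modeOf_eq {r : PRule (Atom L (Term L))} (hr : r ∈ P.rules) :
    P.modeOf r.head.pred = r.disjMode := by
  have h : ∃ s ∈ P.rules, s.head.pred = r.head.pred := ⟨r, hr, rfl⟩
  rw [modeOf, dif_pos h]
  exact P.disjMode_eq _ h.choose_spec.1 _ hr h.choose_spec.2

/-! ### Fixpoint semantics -/

/-- A probabilistic valuation; valuations are ordered pointwise by the truth order. -/
abbrev Valuation : Type := P.HerbrandBase → ConfLevel

/-- The confidence level `c ∧ v(B₁) ∧ ⋯ ∧ v(Bₘ)` which a ground p-rule propagates to its head,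
where `∧` is taken under the conjunctive mode of the rule. -/
def ruleConf (v : P.Valuation) (ρ : PRule P.HerbrandBase) : ConfLevel :=
  ρ.body.foldl (fun c B => c.conj ρ.conjMode (v B)) ρ.conf

/-- The immediate consequence operator: the disjunction, under the disjunctive mode of the
predicate of `A`, of the confidence levels propagated by all ground p-rules which define `A`.
The empty disjunction is the identity `botT`. -/
noncomputable def consequence (v : P.Valuation) : P.Valuation := fun A =>
  (P.rulesFor A).fold (ConfLevel.disj (P.modeOf A.1.pred)) ConfLevel.botT (P.ruleConf v)

/-- Bottom-up iteration from the valuation **false**, for a finite number of steps. -/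
noncomputable def iter (n : ℕ) : P.Valuation :=
  P.consequence^[n] (fun _ => ConfLevel.botT)

/-- Naive bottom-up evaluation computes `iter 1`, `iter 2`, … and stops after the first iteration
that does not change the valuation; this says that it stops after exactly `n` iterations. -/
def NaiveStopsAfter (n : ℕ) : Prop :=
  IsLeast {m | 1 ≤ m ∧ P.iter m = P.iter (m - 1)} n

/-! ### Recursive predicates -/

/-- Some rule has the predicate `p` in its head and the predicate `q` in its body. -/
def DependsOn (p q : L.Pred) : Prop :=
  ∃ r ∈ P.rules, r.head.pred = p ∧ ∃ b ∈ r.body, b.pred = q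

/-- A predicate is recursive if it depends, directly or indirectly, on itself. -/
def IsRecursive (p : L.Pred) : Prop :=
  Relation.TransGen P.DependsOn p p

/-! ### Disjunctive derivation trees -/

/-- Disjunctive derivation trees for `A`: finite ground disjunctive proof trees which are well-formed,
so that they have no failure nodes and no two rule children of a goal node carry the same ground
rule. The root is a goal node labelled `A`; its rule children form a non-empty set `S` of ground
p-rules which define `A`; a rule node has a goal child, with the tree below it, for each atom of the
body, and is a leaf if the rule is a fact. -/
inductive DDT : P.HerbrandBase → Type
  | node (A : P.HerbrandBase) (S : Finset (PRule P.HerbrandBase)) (nonempty : S.Nonempty)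
      (inst : ∀ ρ ∈ S, ρ ∈ P.instantiation ∧ ρ.head = A)
      (sub : ∀ ρ ∈ S, ∀ i : Fin ρ.body.length, DDT (ρ.body.get i)) : DDT A

namespace DDT

variable {P}

/-- The height of a tree: the maximal number of edges on a path from the root to a leaf. The
first `1 +` is for the edge from the root to a rule child, the second one for the edge from the rule
child to one of its goal children. -/
def height : {A : P.HerbrandBase} → P.DDT A → ℕ
  | _, .node _ S _ _ sub =>
    1 + S.attach.sup fun ρ => Finset.univ.sup fun i => 1 + (sub ρ.1 ρ.2 i).height

/-- The branches of a tree: at each goal node of the branch choose exactly one rule child, and keep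
all goal children of a rule node. -/
inductive Branch : {A : P.HerbrandBase} → P.DDT A → Type
  | node {A : P.HerbrandBase} {S : Finset (PRule P.HerbrandBase)} {nonempty : S.Nonempty}
      {inst : ∀ ρ ∈ S, ρ ∈ P.instantiation ∧ ρ.head = A}
      {sub : ∀ ρ ∈ S, ∀ i : Fin ρ.body.length, P.DDT (ρ.body.get i)}
      (ρ : PRule P.HerbrandBase) (hρ : ρ ∈ S)
      (below : ∀ i : Fin ρ.body.length, Branch (sub ρ hρ i)) :
      Branch (.node A S nonempty inst sub)

/-- Some goal node of the branch is labelled `B`. -/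
def Branch.Contains (B : P.HerbrandBase) :
    {A : P.HerbrandBase} → {T : P.DDT A} → Branch T → Prop
  | A, _, .node _ _ below => A = B ∨ ∃ i, (below i).Contains B

/-- The branch contains two goal nodes labelled `B`, one of which is a proper ancestor of the
other. -/
def Branch.Repeats (B : P.HerbrandBase) :
    {A : P.HerbrandBase} → {T : P.DDT A} → Branch T → Prop
  | A, _, .node _ _ below =>
    (A = B ∧ ∃ i, (below i).Contains B) ∨ ∃ i, (below i).Repeats B

/-- A tree is simple if, for every atom `B`, none of its branches contains two goal nodes labelled
`B`, one of which is an ancestor of the other. -/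
def Simple {A : P.HerbrandBase} (T : P.DDT A) : Prop :=
  ∀ (B : P.HerbrandBase) (b : Branch T), ¬ b.Repeats B

end DDT

end PProgram

end PDD

/-! If a value still grew in step `k + 1`, some simple tree would have height at least `2 * k + 1`,
more than the maximum allows. `exists_simple_of_coord_lt` builds this tree by following one
coordinate of the confidence levels. Once doubt is reversed, every connective acts on each
coordinate separately and monotonically.

A coordinate of `A` that grows in step `m + 1` grows because of some rule
(`exists_coord_lt_of_fold_disj`). For `m > 0`, some body atom of this rule grew in step `m`;
iterating this gives a long path. Conjunctions lie below their conjuncts, so the other body atoms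
have positive values too; each receives the tree of the step in which its current value was reached
(`exists_strict_stage`). Every goal node gets a single rule.

Simplicity is where positive correlation enters. On a cycle through `A` all heads are recursive, so
disjunction is a maximum, attained by the chosen rule. Values therefore do not decrease on the way
down, and a second occurrence of `A` would have had the new value of `A` one step too early. -/

namespace PDD

namespace ConfLevel

/-- The four coordinates of a confidence level, with doubt reversed, so that the truth order is the
product order of the coordinates. -/
def coord : Fin 4 → ConfLevel → unitInterval
  | 0, c => c.α
  | 1, c => c.β
  | 2, c => unitInterval.symm c.γ
  | 3, c => unitInterval.symm c.δ

theorem le_iff_coord {c d : ConfLevel} : c ≤ d ↔ ∀ i, coord i c ≤ coord i d := by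
  change (c.α ≤ d.α ∧ c.β ≤ d.β ∧ d.γ ≤ c.γ ∧ d.δ ≤ c.δ) ↔ _
  simp [coord, Fin.forall_fin_succ, unitInterval.symm_le_symm]

@[simp]
theorem coord_botT (i : Fin 4) : coord i botT = 0 := by
  fin_cases i <;> simp [coord, botT]

end ConfLevel

/-! ### Monotonicity and bounds of the operations on the unit interval -/

theorem addTrunc_le_addTrunc {a b a' b' : unitInterval} (h : a ≤ a') (h' : b ≤ b') :
    addTrunc a b ≤ addTrunc a' b' :=
  Subtype.coe_le_coe.1 (min_le_min le_rfl (add_le_add h h'))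

theorem subTrunc_le_subTrunc {a b a' b' : unitInterval} (h : a ≤ a') (h' : b ≤ b') :
    subTrunc a b ≤ subTrunc a' b' :=
  Subtype.coe_le_coe.1 (max_le_max le_rfl
    (sub_le_sub_right (add_le_add (Subtype.coe_le_coe.2 h) (Subtype.coe_le_coe.2 h')) 1))

theorem probSum_le_probSum {a b a' b' : unitInterval} (h : a ≤ a') (h' : b ≤ b') :
    probSum a b ≤ probSum a' b' :=
  unitInterval.symm_le_symm.2
    (mul_le_mul' (unitInterval.symm_le_symm.2 h) (unitInterval.symm_le_symm.2 h'))

theorem le_addTrunc_left (a b : unitInterval) : a ≤ addTrunc a b :=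
  Subtype.coe_le_coe.1 (le_min a.2.2 (by linarith [b.2.1]))

theorem le_addTrunc_right (a b : unitInterval) : b ≤ addTrunc a b :=
  addTrunc_comm b a ▸ le_addTrunc_left b a

theorem subTrunc_le_left (a b : unitInterval) : subTrunc a b ≤ a :=
  Subtype.coe_le_coe.1 (max_le a.2.1 (by linarith [b.2.2]))

theorem subTrunc_le_right (a b : unitInterval) : subTrunc a b ≤ b :=
  subTrunc_comm b a ▸ subTrunc_le_left b a

theorem le_probSum_left (a b : unitInterval) : a ≤ probSum a b := by
  rw [probSum, unitInterval.le_symm_comm]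
  exact unitInterval.mul_le_left

theorem le_probSum_right (a b : unitInterval) : b ≤ probSum a b :=
  probSum_comm b a ▸ le_probSum_left b a

/-! ### Connectives one coordinate at a time -/

namespace ConfLevel

/-- The hypotheses concern coordinate `i` alone: no mode mixes the coordinates, so growth can be
traced in one of them. -/
theorem coord_conj_mono (i : Fin 4) (μ : Mode) {c d c' d' : ConfLevel}
    (h : coord i c ≤ coord i c') (h' : coord i d ≤ coord i d') :
    coord i (c.conj μ d) ≤ coord i (c'.conj μ d') := by
  fin_cases i <;> cases μ <;>
    simp only [coord, conj, unitInterval.symm_le_symm, le_refl] at h h' ⊢ <;>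
    first
    | exact addTrunc_le_addTrunc h h'
    | exact subTrunc_le_subTrunc h h'
    | exact probSum_le_probSum h h'
    | exact mul_le_mul' h h'
    | exact min_le_min h h'
    | exact max_le_max h h'

theorem coord_disj_mono (i : Fin 4) (μ : Mode) {c d c' d' : ConfLevel}
    (h : coord i c ≤ coord i c') (h' : coord i d ≤ coord i d') :
    coord i (c.disj μ d) ≤ coord i (c'.disj μ d') := by
  fin_cases i <;> cases μ <;>
    simp only [coord, disj, unitInterval.symm_le_symm] at h h' ⊢ <;>
    first
    | exact addTrunc_le_addTrunc h h'
    | exact subTrunc_le_subTrunc h h'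
    | exact probSum_le_probSum h h'
    | exact mul_le_mul' h h'
    | exact min_le_min h h'
    | exact max_le_max h h'

theorem coord_conj_le_left (i : Fin 4) (μ : Mode) (c d : ConfLevel) :
    coord i (c.conj μ d) ≤ coord i c := by
  fin_cases i <;> cases μ <;> simp only [coord, conj, unitInterval.symm_le_symm] <;>
    first
    | exact le_addTrunc_left _ _
    | exact subTrunc_le_left _ _
    | exact le_probSum_left _ _
    | exact unitInterval.mul_le_left
    | exact min_le_left _ _
    | exact le_max_left _ _
    | exact unitInterval.nonneg'

theorem coord_conj_le_right (i : Fin 4) (μ : Mode) (c d : ConfLevel) :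
    coord i (c.conj μ d) ≤ coord i d := by
  fin_cases i <;> cases μ <;> simp only [coord, conj, unitInterval.symm_le_symm] <;>
    first
    | exact le_addTrunc_right _ _
    | exact subTrunc_le_right _ _
    | exact le_probSum_right _ _
    | exact unitInterval.mul_le_right
    | exact min_le_right _ _
    | exact le_max_right _ _
    | exact unitInterval.nonneg'

theorem coord_disj_pc (i : Fin 4) (c d : ConfLevel) :
    coord i (c.disj .pc d) = max (coord i c) (coord i d) := by
  have hanti : Antitone unitInterval.symm := fun _ _ h => unitInterval.symm_le_symm.2 h
  fin_cases i
  · rfl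
  · rfl
  · exact hanti.map_min
  · exact hanti.map_min

theorem coord_fold_disj_mono {ι : Type*} (i : Fin 4) (μ : Mode) (s : Finset ι) {g g' : ι → ConfLevel}
    (h : ∀ x ∈ s, coord i (g x) ≤ coord i (g' x)) :
    coord i (s.fold (disj μ) botT g) ≤ coord i (s.fold (disj μ) botT g') := by
  classical
  induction s using Finset.induction_on with
  | empty => simp
  | insert a s ha ih =>
    rw [Finset.fold_insert ha, Finset.fold_insert ha]
    exact coord_disj_mono i μ (h a (Finset.mem_insert_self a s))
      (ih fun x hx => h x (Finset.mem_insert_of_mem hx))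

theorem coord_fold_disj_pc {ι : Type*} (i : Fin 4) (s : Finset ι) (g : ι → ConfLevel) :
    coord i (s.fold (disj .pc) botT g) = s.fold max 0 fun x => coord i (g x) := by
  classical
  induction s using Finset.induction_on with
  | empty => simp
  | insert a s ha ih => rw [Finset.fold_insert ha, Finset.fold_insert ha, coord_disj_pc, ih]

/-- This presents stage `0` as a disjunction over the same rules as stage `1`, so that the first
step can be treated like the later ones. -/
theorem fold_disj_botT {ι : Type*} (μ : Mode) (s : Finset ι) :
    (s.fold (disj μ) botT fun _ => botT) = botT := by
  classical
  have h : botT.disj μ botT = botT := by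
    cases μ <;> simp [disj, botT, addTrunc, subTrunc, probSum]
  induction s using Finset.induction_on with
  | empty => simp
  | insert a s ha ih => rw [Finset.fold_insert ha, ih, h]

/-- If a coordinate of a disjunction increases strictly, then it does so for some disjunct; for
positive correlation, this disjunct attains the new value. -/
theorem exists_coord_lt_of_fold_disj {ι : Type*} (i : Fin 4) (μ : Mode) (s : Finset ι)
    {g g' : ι → ConfLevel}
    (h : coord i (s.fold (disj μ) botT g) < coord i (s.fold (disj μ) botT g')) :
    ∃ x ∈ s, coord i (g x) < coord i (g' x) ∧
      (μ = .pc → coord i (s.fold (disj μ) botT g') ≤ coord i (g' x)) := by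
  by_cases hpc : μ = .pc
  · subst hpc
    have h' := (coord_fold_disj_pc i s g').le
    rw [Finset.le_fold_max] at h'
    rcases h' with h' | ⟨x, hx, h'⟩
    -- The maximum is not just the default `0`, because it exceeds the old value.
    · exact absurd (h.trans_le h') (not_lt.2 unitInterval.nonneg')
    · refine ⟨x, hx, lt_of_le_of_lt ?_ (h.trans_le h'), fun _ => h'⟩
      rw [coord_fold_disj_pc, Finset.le_fold_max]
      exact Or.inr ⟨x, hx, le_rfl⟩
  -- For the other modes the claim is the contrapositive of monotonicity.
  · by_contra! hcon
    refine absurd h (not_lt.2 (coord_fold_disj_mono i _ _ fun x hx => ?_))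
    by_contra! hlt
    exact hpc (hcon x hx hlt).1

theorem coord_foldl_conj_mono {ι : Type*} (i : Fin 4) (μ : Mode) (l : List ι) {v v' : ι → ConfLevel}
    (h : ∀ x ∈ l, coord i (v x) ≤ coord i (v' x)) {c c' : ConfLevel}
    (hc : coord i c ≤ coord i c') :
    coord i (l.foldl (fun c x => c.conj μ (v x)) c) ≤
      coord i (l.foldl (fun c x => c.conj μ (v' x)) c') := by
  induction l generalizing c c' with
  | nil => exact hc
  | cons a l ih =>
    exact ih (fun x hx => h x (List.mem_cons_of_mem a hx))
      (coord_conj_mono i μ hc (h a List.mem_cons_self))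

theorem coord_foldl_conj_le {ι : Type*} (i : Fin 4) (μ : Mode) (l : List ι) (v : ι → ConfLevel)
    (c : ConfLevel) :
    coord i (l.foldl (fun c x => c.conj μ (v x)) c) ≤ coord i c ∧
      ∀ x ∈ l, coord i (l.foldl (fun c x => c.conj μ (v x)) c) ≤ coord i (v x) := by
  induction l generalizing c with
  | nil => simp
  | cons a l ih =>
    obtain ⟨h, h'⟩ := ih (c.conj μ (v a))
    refine ⟨h.trans (coord_conj_le_left i μ _ _), fun x hx => ?_⟩
    rcases List.mem_cons.1 hx with rfl | hx
    · exact h.trans (coord_conj_le_right i μ _ _)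
    · exact h' x hx

end ConfLevel

/-! ### Bottom-up iteration and the construction of simple trees -/

namespace PProgram

open ConfLevel Relation

variable {L : Lang} (P : PProgram L)

theorem coord_ruleConf_mono (i : Fin 4) {v v' : P.Valuation} {ρ : PRule P.HerbrandBase}
    (h : ∀ B ∈ ρ.body, coord i (v B) ≤ coord i (v' B)) :
    coord i (P.ruleConf v ρ) ≤ coord i (P.ruleConf v' ρ) :=
  coord_foldl_conj_mono i _ _ h le_rfl

theorem coord_ruleConf_le (i : Fin 4) (v : P.Valuation) {ρ : PRule P.HerbrandBase}
    {B : P.HerbrandBase} (hB : B ∈ ρ.body) : coord i (P.ruleConf v ρ) ≤ coord i (v B) :=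
  (coord_foldl_conj_le i _ _ v _).2 B hB

theorem consequence_mono : Monotone P.consequence := fun _ _ h _ =>
  le_iff_coord.2 fun i => coord_fold_disj_mono i _ _ fun _ _ =>
    P.coord_ruleConf_mono i fun B _ => le_iff_coord.1 (h B) i

theorem botT_le (c : ConfLevel) : botT ≤ c :=
  le_iff_coord.2 fun i => by simp

theorem iter_succ (n : ℕ) : P.iter (n + 1) = P.consequence (P.iter n) :=
  Function.iterate_succ_apply' _ _ _

theorem iter_mono : Monotone P.iter :=
  P.consequence_mono.monotone_iterate_of_le_map fun _ => botT_le _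

theorem coord_iter_mono (i : Fin 4) (A : P.HerbrandBase) :
    Monotone fun n => coord i (P.iter n A) :=
  fun _ _ h => le_iff_coord.1 (P.iter_mono h A) i

theorem iter_le_of_consequence_eq {v : P.Valuation} (hv : P.consequence v = v) (n : ℕ) :
    P.iter n ≤ v := by
  induction n with
  | zero => exact fun _ => botT_le _
  | succ n ih => exact P.iter_succ n ▸ (P.consequence_mono ih).trans_eq hv

theorem exists_rule_of_mem_instantiation {ρ : PRule P.HerbrandBase} (hρ : ρ ∈ P.instantiation) :
    ∃ r ∈ P.rules, r.head.pred = ρ.head.1.pred ∧ r.disjMode = ρ.disjMode ∧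
      ∀ B ∈ ρ.body, ∃ b ∈ r.body, b.pred = B.1.pred := by
  obtain ⟨r, hr, θ, -, h⟩ := hρ
  simp only [PRule.map, PRule.mk.injEq] at h
  obtain ⟨hh, -, hb, -, hd⟩ := h
  refine ⟨r, hr, (congrArg Atom.pred hh).symm, hd.symm, fun B hB => ?_⟩
  have : B.1 ∈ r.body.map (Atom.subst θ) := hb ▸ List.mem_map_of_mem hB
  obtain ⟨b, hb, h⟩ := List.mem_map.1 this
  exact ⟨b, hb, congrArg Atom.pred h⟩

theorem dependsOn_of_mem_body {ρ : PRule P.HerbrandBase} (hρ : ρ ∈ P.instantiation)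
    {B : P.HerbrandBase} (hB : B ∈ ρ.body) : P.DependsOn ρ.head.1.pred B.1.pred := by
  obtain ⟨r, hr, h, -, hb⟩ := P.exists_rule_of_mem_instantiation hρ
  exact ⟨r, hr, h, hb B hB⟩

/-- A positive coordinate of `iter m B` has been reached at some stage by a strict increase. -/
theorem exists_strict_stage (i : Fin 4) {m : ℕ} {B : P.HerbrandBase}
    (h : 0 < coord i (P.iter m B)) :
    ∃ n < m, coord i (P.iter n B) < coord i (P.iter (n + 1) B) ∧
      coord i (P.iter (n + 1) B) = coord i (P.iter m B) := by
  induction m with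
  | zero => simp [iter] at h
  | succ m ih =>
    rcases (P.coord_iter_mono i B m.le_succ).lt_or_eq with hlt | heq
    · exact ⟨m, m.lt_succ_self, hlt, rfl⟩
    · dsimp only at heq
      obtain ⟨n, hn, h₁, h₂⟩ := ih (heq ▸ h)
      exact ⟨n, hn.trans m.lt_succ_self, h₁, h₂.trans heq⟩

/-- An atom with a coordinate which increases strictly in step `m + 1` has a simple tree of height
at least `2 * m + 1`. Below the root, this coordinate does not decrease along cyclic
dependencies. -/
theorem exists_simple_of_coord_lt
    (hpc : ∀ r ∈ P.rules, P.IsRecursive r.head.pred → r.disjMode = Mode.pc) (i : Fin 4) (m : ℕ) :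
    ∀ A : P.HerbrandBase, coord i (P.iter m A) < coord i (P.iter (m + 1) A) →
      ∃ T : P.DDT A, T.Simple ∧ 2 * m + 1 ≤ T.height ∧
        ∀ (b : DDT.Branch T) (C : P.HerbrandBase), b.Contains C →
          ReflTransGen P.DependsOn A.1.pred C.1.pred ∧
          (ReflTransGen P.DependsOn C.1.pred A.1.pred →
            coord i (P.iter (m + 1) A) ≤ coord i (P.iter (m + 1) C)) := by
  induction m using Nat.strong_induction_on with
  | _ m ih =>
  intro A hA
  -- The rule responsible for the growth of `A`. For `m = 0` there is no earlier stage to compare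
  -- with, and only positivity remains.
  obtain ⟨ρ, hρ, hlow, hlt, hmax⟩ : ∃ ρ ∈ P.rulesFor A,
      0 < coord i (P.ruleConf (P.iter m) ρ) ∧
      (∀ n, m = n + 1 →
        coord i (P.ruleConf (P.iter n) ρ) < coord i (P.ruleConf (P.iter m) ρ)) ∧
      (P.modeOf A.1.pred = .pc →
        coord i (P.iter (m + 1) A) ≤ coord i (P.ruleConf (P.iter m) ρ)) := by
    rcases m with _ | n
    · have h₀ : P.iter 0 A =
          (P.rulesFor A).fold (disj (P.modeOf A.1.pred)) botT fun _ => botT := by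
        rw [fold_disj_botT]
        rfl
      rw [h₀, iter_succ] at hA
      obtain ⟨ρ, hρ, h, h'⟩ := exists_coord_lt_of_fold_disj i _ _ hA
      refine ⟨ρ, hρ, unitInterval.nonneg'.trans_lt h, fun n hn => by omega, ?_⟩
      rwa [iter_succ]
    · rw [iter_succ, P.iter_succ (n + 1)] at hA
      obtain ⟨ρ, hρ, h, h'⟩ := exists_coord_lt_of_fold_disj i _ _ hA
      refine ⟨ρ, hρ, unitInterval.nonneg'.trans_lt h, fun n' hn => ?_, ?_⟩
      · obtain rfl : n = n' := by omega
        exact h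
      · rwa [P.iter_succ (n + 1)]
  obtain ⟨hinst, hhead⟩ := P.mem_rulesFor.1 hρ
  have hpos (B) (hB : B ∈ ρ.body) : 0 < coord i (P.iter m B) :=
    hlow.trans_le (P.coord_ruleConf_le i _ hB)
  -- Quantifying over the singleton lets `choose` return subtrees in the form that `DDT.node`
  -- expects.
  have hsub : ∀ ρ' ∈ ({ρ} : Finset (PRule P.HerbrandBase)), ∀ j : Fin ρ'.body.length,
      ∃ T : P.DDT (ρ'.body.get j), T.Simple ∧
        (∀ n, m = n + 1 → coord i (P.iter n (ρ'.body.get j)) < coord i (P.iter m (ρ'.body.get j)) →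
          2 * n + 1 ≤ T.height) ∧
        ∀ (b : DDT.Branch T) (C : P.HerbrandBase), b.Contains C →
          ReflTransGen P.DependsOn (ρ'.body.get j).1.pred C.1.pred ∧
          (ReflTransGen P.DependsOn C.1.pred (ρ'.body.get j).1.pred →
            coord i (P.iter m (ρ'.body.get j)) ≤ coord i (P.iter m C)) := by
    intro ρ' hρ' j
    obtain rfl := Finset.mem_singleton.1 hρ'
    obtain ⟨n, hn, h₁, h₂⟩ := P.exists_strict_stage i (hpos _ (List.get_mem _ j))
    obtain ⟨T, hT, hh, hC⟩ := ih n hn _ h₁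
    refine ⟨T, hT, fun n' hn' hlt => ?_, fun b C hbC => ⟨(hC b C hbC).1, fun hr => ?_⟩⟩
    -- The value is constant from stage `n + 1` to stage `m`, so growth in the last of these steps
    -- forces that step to be the one chosen.
    · have : n' ≤ n := by
        by_contra! hcon
        exact absurd (hlt.trans_eq h₂.symm) (not_lt.2 (P.coord_iter_mono i _ hcon))
      omega
    · exact h₂.ge.trans (((hC b C hbC).2 hr).trans (P.coord_iter_mono i C hn))
  choose sub hsimple hheight hcont using hsub
  -- a body atom on a cycle through `A` has at least the value of `A`
  have hcycle (B : P.HerbrandBase) (hB : B ∈ ρ.body)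
      (hr : ReflTransGen P.DependsOn B.1.pred A.1.pred) :
      coord i (P.iter (m + 1) A) ≤ coord i (P.iter m B) := by
    have hAB := hhead ▸ P.dependsOn_of_mem_body hinst hB
    obtain ⟨r, hr', hp, -⟩ := P.exists_rule_of_mem_instantiation hinst
    rw [hhead] at hp
    refine (hmax ?_).trans (P.coord_ruleConf_le i _ hB)
    rw [← hp, P.modeOf_eq hr']
    exact hpc r hr' (by rw [hp]; exact TransGen.head' hAB hr)
  -- If `A` recurred below the body atom `B`, its value at stage `m + 1` would be at most that of
  -- `B` at stage `m`, hence at most its own at stage `m`.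
  have hnot (hm : ρ ∈ ({ρ} : Finset (PRule P.HerbrandBase))) (j) (b : DDT.Branch (sub ρ hm j)) :
      ¬ b.Contains A := by
    intro hb
    obtain ⟨h₁, h₂⟩ := hcont ρ hm j b A hb
    have hB := List.get_mem ρ.body j
    have hAB := hhead ▸ P.dependsOn_of_mem_body hinst hB
    exact absurd hA (not_lt.2 ((hcycle _ hB h₁).trans (h₂ (.single hAB))))
  refine ⟨.node A {ρ} (Finset.singleton_nonempty ρ)
    (fun ρ' h => by rw [Finset.mem_singleton.1 h]; exact ⟨hinst, hhead⟩) sub, ?_, ?_, ?_⟩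
  · intro B b hb
    rcases b with ⟨ρ', hρ', below⟩
    obtain rfl := Finset.mem_singleton.1 hρ'
    rcases hb with ⟨rfl, j, hj⟩ | ⟨j, hj⟩
    · exact hnot hρ' j _ hj
    · exact hsimple _ hρ' j B _ hj
  · rcases m with _ | n
    · simp [DDT.height]
    -- The subtree of a body atom that grew has height at least `2 * n + 1`; the two edges from `A`
    -- down to it give `2 * (n + 1) + 1`.
    · obtain ⟨B, hB, hlt'⟩ : ∃ B ∈ ρ.body,
          coord i (P.iter n B) < coord i (P.iter (n + 1) B) := by
        by_contra! hcon
        exact absurd (hlt n rfl) (not_lt.2 (P.coord_ruleConf_mono i hcon))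
      obtain ⟨j, rfl⟩ := List.get_of_mem hB
      have hm := Finset.mem_singleton_self ρ
      have h := hheight ρ hm j n rfl hlt'
      have h₁ : 1 + (sub ρ hm j).height ≤
          Finset.univ.sup fun j => 1 + (sub ρ hm j).height :=
        Finset.le_sup (f := fun j => 1 + (sub ρ hm j).height) (Finset.mem_univ j)
      have h₂ := Finset.le_sup
        (f := fun ρ' : {x // x ∈ ({ρ} : Finset (PRule P.HerbrandBase))} =>
          Finset.univ.sup fun j => 1 + (sub ρ'.1 ρ'.2 j).height)
        (Finset.mem_attach _ ⟨ρ, hm⟩)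
      rw [DDT.height]
      dsimp only at h₂
      omega
  · intro b C hb
    rcases b with ⟨ρ', hρ', below⟩
    obtain rfl := Finset.mem_singleton.1 hρ'
    rcases hb with rfl | ⟨j, hj⟩
    · exact ⟨.refl, fun _ => le_rfl⟩
    · obtain ⟨h₁, h₂⟩ := hcont _ hρ' j _ C hj
      have hB := List.get_mem ρ'.body j
      have hAB := hhead ▸ P.dependsOn_of_mem_body hinst hB
      refine ⟨h₁.head hAB, fun hr => ?_⟩
      -- The chain runs from `A` at stage `m + 1` through the body atom and `C` at stage `m` to `C`
      -- at stage `m + 1`.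
      exact (hcycle _ hB (h₁.trans hr)).trans
        ((h₂ (hr.tail hAB)).trans (P.coord_iter_mono i C m.le_succ))

end PProgram

end PDD

/-! ### Termination and the least fixpoint -/

theorem theorem7p1 (L : PDD.Lang) (P : PDD.PProgram L)
    (hpc : ∀ r ∈ P.rules, P.IsRecursive r.head.pred → r.disjMode = PDD.Mode.pc)
    (k : ℕ) (hk : 1 ≤ k)
    (hmax : IsGreatest
      {h : ℕ | ∃ (A : P.HerbrandBase) (T : P.DDT A), T.Simple ∧ T.height = h} (2 * k - 1)) :
    ∃ n ≤ k + 1, P.NaiveStopsAfter n ∧ IsLeast (Function.fixedPoints P.consequence) (P.iter n) := by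
  have hfix : P.iter (k + 1) = P.iter k := by
    refine le_antisymm (fun A => PDD.ConfLevel.le_iff_coord.2 fun i => ?_)
      (P.iter_mono k.le_succ)
    by_contra! h
    obtain ⟨T, hT, hheight, -⟩ := P.exists_simple_of_coord_lt hpc i k A h
    have := hmax.2 ⟨A, T, hT, rfl⟩
    omega
  classical
  -- The evaluation may stop before `k + 1`, so the first unchanged stage is taken; being unchanged
  -- is what makes it a fixpoint.
  have hex : ∃ m, 1 ≤ m ∧ P.iter m = P.iter (m - 1) := ⟨k + 1, by omega, hfix⟩
  obtain ⟨hn, heq⟩ := Nat.find_spec hex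
  refine ⟨Nat.find hex, Nat.find_min' hex ⟨by omega, hfix⟩,
    ⟨Nat.find_spec hex, fun m hm => Nat.find_min' hex hm⟩, ?_,
    fun v hv => P.iter_le_of_consequence_eq hv _⟩
  obtain ⟨m, hm⟩ := Nat.exists_eq_add_of_le' hn
  rw [hm] at heq ⊢
  change P.consequence _ = _
  rw [heq, Nat.add_sub_cancel, ← P.iter_succ, heq, Nat.add_sub_cancel]
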